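/- Let $d\ge 1$ and let $\Omega\subset\mathbb{R}^d$ be a bounded open set. Let $A^\varepsilon\in (L^\infty(\Omega))^{d\times d}$ be a (not necessarily symmetric) matrix field that is elliptic: there are $0<\alpha_1\le\alpha_2$ such that, for every $\xi\in\mathbb{R}^d$, $\alpha_1|\xi|^2\le (A^\varepsilon(x)\xi)\cdot\xi\le\alpha_2|\xi|^2$ for almost every $x\in\Omega$. Let $b\in(L^\infty(\Omega))^d$ with $\operatorname{div} b=0$ in $\Omega$ (in the sense of distributions), let $f\in L^2(\Omega)$ and let $\alpha_{\rm spl}>0$. Let $H^1_0(\Omega)$ be the closure of $C_c^\infty(\Omega)$ in $H^1(\Omega)$, and let $C_\Omega$ be the Poincaré constant of $\Omega$, i.e. the least $C\ge 0$ such that $\|\varphi\|_{L^2(\Omega)}\le C\,\|\nabla\varphi\|_{L^2(\Omega)}$ for all $\varphi\in H^1_0(\Omega)$. The norms $\|b\|_{L^\infty(\Omega)}$ and $\|A^\varepsilon-\alpha_{\rm spl}\mathrm{Id}\|_{L^\infty(\Omega)}$ are the essential suprema over $\Omega$ of the Euclidean norm and of the associated operator norm, respectively. All boundary value problems are understood in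 their variational formulation in $H^1_0(\Omega)$. Given $u_0,u_1\in H^1_0(\Omega)$ (e.g. $u_0=u_1=0$), the splitting iteration defines $u_n\in H^1_0(\Omega)$ by, for $n\ge 0$, $$-\alpha_{\rm spl}\Delta u_{2n+2}+b\cdot\nabla u_{2n+2}=f+b\cdot\nabla(u_{2n}-u_{2n+1})\ \text{ in }\Omega,\qquad u_{2n+2}=0\ \text{ on }\partial\Omega,$$ $$-\operatorname{div}(A^\varepsilon\nabla u_{2n+3})=-\alpha_{\rm spl}\Delta u_{2n+2}\ \text{ in }\Omega,\qquad u_{2n+3}=0\ \text{ on }\partial\Omega.$$ Assume that $$\frac{C_\Omega\,\|b\|_{L^\infty(\Omega)}}{\alpha_1}\left(\frac{\|A^\varepsilon-\alpha_{\rm spl}\mathrm{Id}\|_{L^\infty(\Omega)}}{\alpha_{\rm spl}}\right)<1 .$$ Then the problem $$-\operatorname{div}(A^\varepsilon\nabla u^\varepsilon)+b\cdot\nabla u^\varepsilon=f\ \text{ in }\Omega,\qquad u^\varepsilon=0\ \text{ on }\partial\Omega,$$ has a unique solution $u^\varepsilon\in H^1_0(\Omega)$; for any initial values $u_0,u_1\in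 H^1_0(\Omega)$ the iteration defines a unique sequence $(u_n)_{n\ge 0}$ in $H^1_0(\Omega)$; and $u_{2n+1}$ converges to $u^\varepsilon$ in $H^1_0(\Omega)$ as $n\to\infty$. -/

import Mathlib

open MeasureTheory Filter Topology
open scoped Distributions ENNReal

noncomputable section

namespace SplittingMethod

/-- The Euclidean space `ℝ^d`. -/
abbrev Eucl (d : ℕ) : Type := EuclideanSpace ℝ (Fin d)

variable {d : ℕ}

/-- Lebesgue measure on the open set `Ω`. -/
abbrev vol (Ω : TopologicalSpace.Opens (Eucl d)) : Measure (Eucl d) :=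
  volume.restrict (Ω : Set (Eucl d))

/-- The Hilbert space `L²(Ω) × L²(Ω)^d` of pairs `(u, g)`, with the norm
`(‖u‖² + ‖g‖²)^(1/2)`. When `g` is the weak gradient of `u` this is the norm of `H¹(Ω)`. -/
abbrev L2Pair (Ω : TopologicalSpace.Opens (Eucl d)) : Type :=
  WithLp 2 (Lp ℝ 2 (vol Ω) × Lp (Eucl d) 2 (vol Ω))

/-- `g` is the weak (distributional) gradient of `u` on `Ω`:
`∫_Ω u ∂_i φ = - ∫_Ω g_i φ` for all `φ ∈ C_c^∞(Ω)` and all `i`. -/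
def HasWeakGradient (Ω : TopologicalSpace.Opens (Eucl d)) (u : Eucl d → ℝ)
    (g : Eucl d → Eucl d) : Prop :=
  ∀ (φ : 𝓓(Ω, ℝ)) (i : Fin d),
    ∫ x in (Ω : Set (Eucl d)), u x * gradient φ x i = - ∫ x in (Ω : Set (Eucl d)), g x i * φ x

/-- The pairs `(φ, ∇φ)` with `φ ∈ C_c^∞(Ω)`. -/
def testPairs (Ω : TopologicalSpace.Opens (Eucl d)) : Submodule ℝ (L2Pair Ω) where
  carrier := {z | ∃ φ : 𝓓(Ω, ℝ), z.fst =ᵐ[vol Ω] φ ∧ z.snd =ᵐ[vol Ω] gradient φ}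
  zero_mem' := by
    refine ⟨0, ?_, ?_⟩
    · filter_upwards [Lp.coeFn_zero ℝ 2 (vol Ω)] with x hx
      simpa using hx
    · filter_upwards [Lp.coeFn_zero (Eucl d) 2 (vol Ω)] with x hx
      have h0 : ((0 : 𝓓(Ω, ℝ)) : Eucl d → ℝ) = fun _ => 0 := by ext y; simp
      rw [h0, gradient_fun_const]
      simpa using hx
  add_mem' := by
    rintro z w ⟨φ, h1, h2⟩ ⟨ψ, k1, k2⟩
    refine ⟨φ + ψ, ?_, ?_⟩
    · filter_upwards [h1, k1, Lp.coeFn_add z.fst w.fst] with x a b c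
      simp only [WithLp.add_fst, c, Pi.add_apply, a, b]
      rfl
    · filter_upwards [h2, k2, Lp.coeFn_add z.snd w.snd] with x a b c
      have hφ : DifferentiableAt ℝ φ x := φ.contDiff.differentiable (by simp) x
      have hψ : DifferentiableAt ℝ ψ x := ψ.contDiff.differentiable (by simp) x
      simp only [WithLp.add_snd, c, Pi.add_apply, a, b]
      simp only [gradient]
      rw [← map_add, ← fderiv_add hφ hψ]
      rfl
  smul_mem' := by
    rintro r z ⟨φ, h1, h2⟩
    refine ⟨r • φ, ?_, ?_⟩
    · filter_upwards [h1, Lp.coeFn_smul r z.fst] with x a c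
      simp only [WithLp.smul_fst, c, Pi.smul_apply, a]
      rfl
    · filter_upwards [h2, Lp.coeFn_smul r z.snd] with x a c
      have hφ : DifferentiableAt ℝ φ x := φ.contDiff.differentiable (by simp) x
      simp only [WithLp.smul_snd, c, Pi.smul_apply, a]
      simp only [gradient]
      rw [show ((r • φ : 𝓓(Ω, ℝ)) : Eucl d → ℝ) = r • (φ : Eucl d → ℝ) from rfl,
        fderiv_const_smul hφ, map_smul]

/-- The Sobolev space `H¹₀(Ω)`: the closure of `C_c^∞(Ω)` for the norm of `H¹(Ω)`. An element is
stored as the pair `(u, ∇u)`. It carries the norm of `H¹(Ω)`. -/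
def H10 (Ω : TopologicalSpace.Opens (Eucl d)) : Submodule ℝ (L2Pair Ω) :=
  (testPairs Ω).topologicalClosure

/-- The function underlying an element of `H¹₀(Ω)`. -/
def toFn {Ω : TopologicalSpace.Opens (Eucl d)} (u : H10 Ω) : Lp ℝ 2 (vol Ω) :=
  (u : L2Pair Ω).fst

/-- The weak gradient of an element of `H¹₀(Ω)`, see `hasWeakGradient_weakGrad`. -/
def weakGrad {Ω : TopologicalSpace.Opens (Eucl d)} (u : H10 Ω) : Lp (Eucl d) 2 (vol Ω) :=
  (u : L2Pair Ω).snd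

/-- The Poincaré constant `C_Ω`: the least `C ≥ 0` with `‖φ‖_{L²(Ω)} ≤ C ‖∇φ‖_{L²(Ω)}` for all
`φ ∈ H¹₀(Ω)`. -/
def poincareConstant (Ω : TopologicalSpace.Opens (Eucl d)) : ℝ :=
  sInf {C : ℝ | 0 ≤ C ∧ ∀ φ : H10 Ω, ‖toFn φ‖ ≤ C * ‖weakGrad φ‖}

/-- The norm of `L^∞(Ω)`: the essential supremum over `Ω` of the norm of the values. -/
def linftyNorm {F : Type*} [NormedAddCommGroup F] (Ω : TopologicalSpace.Opens (Eucl d))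
    (g : Eucl d → F) : ℝ :=
  (eLpNorm g ∞ (vol Ω)).toReal

/-- A matrix as a linear map of the Euclidean space `ℝ^d`. Its norm is the operator norm
subordinate to the Euclidean norm. -/
abbrev matMap (M : Matrix (Fin d) (Fin d) ℝ) : Eucl d →L[ℝ] Eucl d :=
  Matrix.toEuclideanCLM (𝕜 := ℝ) M

/-- Ellipticity of the (not necessarily symmetric) matrix field `A` on `Ω`. -/
def IsElliptic (Ω : TopologicalSpace.Opens (Eucl d)) (A : Eucl d → Matrix (Fin d) (Fin d) ℝ)
    (α₁ α₂ : ℝ) : Prop :=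
  0 < α₁ ∧ α₁ ≤ α₂ ∧ ∀ ξ : Eucl d, ∀ᵐ x ∂(vol Ω),
    α₁ * ‖ξ‖ ^ 2 ≤ inner ℝ (matMap (A x) ξ) ξ ∧ inner ℝ (matMap (A x) ξ) ξ ≤ α₂ * ‖ξ‖ ^ 2

/-- `div b = 0` in `Ω`, in the sense of distributions. -/
def IsDivFree (Ω : TopologicalSpace.Opens (Eucl d)) (b : Eucl d → Eucl d) : Prop :=
  ∀ φ : 𝓓(Ω, ℝ), ∫ x in (Ω : Set (Eucl d)), inner ℝ (b x) (gradient φ x) = 0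

variable {Ω : TopologicalSpace.Opens (Eucl d)}

/-- `∫_Ω (A ∇u) · ∇v`. -/
def diffusionForm (A : Eucl d → Matrix (Fin d) (Fin d) ℝ) (u v : H10 Ω) : ℝ :=
  ∫ x in (Ω : Set (Eucl d)), inner ℝ (matMap (A x) (weakGrad u x)) (weakGrad v x)

/-- `∫_Ω ∇u · ∇v`. -/
def dirichletForm (u v : H10 Ω) : ℝ :=
  ∫ x in (Ω : Set (Eucl d)), inner ℝ (weakGrad u x) (weakGrad v x)

/-- `∫_Ω (b · ∇u) v`. -/
def advectionForm (b : Eucl d → Eucl d) (u v : H10 Ω) : ℝ :=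
  ∫ x in (Ω : Set (Eucl d)), inner ℝ (b x) (weakGrad u x) * toFn v x

/-- `∫_Ω f v`. -/
def load (f : Eucl d → ℝ) (v : H10 Ω) : ℝ :=
  ∫ x in (Ω : Set (Eucl d)), f x * toFn v x

/-- `u ∈ H¹₀(Ω)` is the (variational) solution of `-div(A ∇u) + b · ∇u = f` in `Ω`, `u = 0` on
`∂Ω`. -/
def IsSolution (A : Eucl d → Matrix (Fin d) (Fin d) ℝ) (b : Eucl d → Eucl d) (f : Eucl d → ℝ)
    (u : H10 Ω) : Prop :=
  ∀ v : H10 Ω, diffusionForm A u v + advectionForm b u v = load f v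

/-- The sequence `u` follows the splitting iteration, each step being understood in its
variational formulation in `H¹₀(Ω)`. -/
structure IsSplittingSequence (A : Eucl d → Matrix (Fin d) (Fin d) ℝ) (b : Eucl d → Eucl d)
    (f : Eucl d → ℝ) (αspl : ℝ) (u : ℕ → H10 Ω) : Prop where
  /-- `-αspl Δu_{2n+2} + b · ∇u_{2n+2} = f + b · ∇(u_{2n} - u_{2n+1})` in `Ω`. -/
  even_step : ∀ (n : ℕ) (v : H10 Ω),
    αspl * dirichletForm (u (2 * n + 2)) v + advectionForm b (u (2 * n + 2)) v =
      load f v + advectionForm b (u (2 * n) - u (2 * n + 1)) v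
  /-- `-div(A ∇u_{2n+3}) = -αspl Δu_{2n+2}` in `Ω`. -/
  odd_step : ∀ (n : ℕ) (v : H10 Ω),
    diffusionForm A (u (2 * n + 3)) v = αspl * dirichletForm (u (2 * n + 2)) v

section WeakGradient

lemma gradient_coord (φ : 𝓓(Ω, ℝ)) (i : Fin d) (x : Eucl d) :
    gradient φ x i = fderiv ℝ φ x (EuclideanSpace.single i 1) := by
  have h : inner ℝ (gradient φ x) (EuclideanSpace.single i (1 : ℝ)) =
      fderiv ℝ φ x (EuclideanSpace.single i 1) := by
    simp [gradient]
  rw [← h, EuclideanSpace.inner_single_right]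
  simp

lemma continuous_partial (φ : 𝓓(Ω, ℝ)) (i : Fin d) :
    Continuous fun x => fderiv ℝ φ x (EuclideanSpace.single i (1 : ℝ)) :=
  (φ.contDiff.continuous_fderiv (by simp)).clm_apply continuous_const

lemma memLp_partial (φ : 𝓓(Ω, ℝ)) (i : Fin d) :
    MemLp (fun x => gradient φ x i) 2 (vol Ω) := by
  simp_rw [gradient_coord]
  exact ((continuous_partial φ i).memLp_of_hasCompactSupport
    (φ.hasCompactSupport.fderiv_apply (𝕜 := ℝ) _)).restrict _

lemma memLp_smul_single (φ : 𝓓(Ω, ℝ)) (i : Fin d) :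
    MemLp (fun x => EuclideanSpace.single i (φ x)) 2 (vol Ω) := by
  have hc : Continuous fun x => EuclideanSpace.single i (φ x) := by
    have : (fun x => EuclideanSpace.single i (φ x)) =
        fun x => φ x • EuclideanSpace.single i (1 : ℝ) := by
      ext x j
      simp
    rw [this]
    exact φ.continuous.smul continuous_const
  refine (hc.memLp_of_hasCompactSupport (φ.hasCompactSupport.mono ?_)).restrict _
  intro x hx h
  exact hx (by simp [h])

lemma integral_by_parts (η φ : 𝓓(Ω, ℝ)) (i : Fin d) :
    ∫ x in (Ω : Set (Eucl d)), η x * gradient φ x i =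
      - ∫ x in (Ω : Set (Eucl d)), gradient η x i * φ x := by
  simp_rw [gradient_coord]
  have hz : ∀ (θ : 𝓓(Ω, ℝ)) (x : Eucl d), x ∉ (Ω : Set (Eucl d)) → θ x = 0 := fun θ x hx =>
    image_eq_zero_of_notMem_tsupport fun h => hx (θ.tsupport_subset h)
  rw [setIntegral_eq_integral_of_forall_compl_eq_zero (fun x hx => by rw [hz η x hx, zero_mul]),
    setIntegral_eq_integral_of_forall_compl_eq_zero (fun x hx => by rw [hz φ x hx, mul_zero])]
  refine integral_mul_fderiv_eq_neg_fderiv_mul_of_integrable ?_ ?_ ?_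
    (fun x _ => η.contDiff.differentiable (by simp) x)
    (fun x _ => φ.contDiff.differentiable (by simp) x)
  · exact ((continuous_partial η i).mul φ.continuous).integrable_of_hasCompactSupport
      φ.hasCompactSupport.mul_left
  · exact (η.continuous.mul (continuous_partial φ i)).integrable_of_hasCompactSupport
      η.hasCompactSupport.mul_right
  · exact (η.continuous.mul φ.continuous).integrable_of_hasCompactSupport
      η.hasCompactSupport.mul_right

/-- The second component of an element of `H¹₀(Ω)` is the weak gradient of the first one, so that
`H¹₀(Ω)` is a subspace of `H¹(Ω)`. -/
theorem hasWeakGradient_weakGrad (u : H10 Ω) : HasWeakGradient Ω (toFn u) (weakGrad u) := by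
  intro φ i
  have key : ∀ z ∈ (testPairs Ω).topologicalClosure,
      inner ℝ ((memLp_partial φ i).toLp _) z.fst =
        - inner ℝ ((memLp_smul_single φ i).toLp _) z.snd := by
    intro z hz
    have hcl : IsClosed {z : L2Pair Ω | inner ℝ ((memLp_partial φ i).toLp _) z.fst =
        - inner ℝ ((memLp_smul_single φ i).toLp _) z.snd} :=
      isClosed_eq (continuous_const.inner (WithLp.continuous_fst ..))
        (continuous_const.inner (WithLp.continuous_snd ..)).neg
    refine closure_minimal ?_ hcl hz
    rintro w ⟨η, h1, h2⟩
    have e1 : inner ℝ ((memLp_partial φ i).toLp _) w.fst =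
        ∫ x in (Ω : Set (Eucl d)), η x * gradient φ x i := by
      rw [L2.inner_def]
      refine integral_congr_ae ?_
      filter_upwards [(memLp_partial φ i).coeFn_toLp, h1] with x a c
      rw [a, c]
      simp
    have e2 : inner ℝ ((memLp_smul_single φ i).toLp _) w.snd =
        ∫ x in (Ω : Set (Eucl d)), gradient η x i * φ x := by
      rw [L2.inner_def]
      refine integral_congr_ae ?_
      filter_upwards [(memLp_smul_single φ i).coeFn_toLp, h2] with x a c
      rw [a, c, EuclideanSpace.inner_single_left]
      simp [mul_comm]
    show _ = _
    rw [e1, e2]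
    exact integral_by_parts η φ i
  have h := key u u.2
  have e1 : inner ℝ ((memLp_partial φ i).toLp _) (u : L2Pair Ω).fst =
      ∫ x in (Ω : Set (Eucl d)), toFn u x * gradient φ x i := by
    rw [L2.inner_def]
    refine integral_congr_ae ?_
    filter_upwards [(memLp_partial φ i).coeFn_toLp] with x a
    rw [a]
    simp [toFn]
  have e2 : inner ℝ ((memLp_smul_single φ i).toLp _) (u : L2Pair Ω).snd =
      ∫ x in (Ω : Set (Eucl d)), weakGrad u x i * φ x := by
    rw [L2.inner_def]
    refine integral_congr_ae ?_
    filter_upwards [(memLp_smul_single φ i).coeFn_toLp] with x a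
    rw [a, EuclideanSpace.inner_single_left]
    simp [weakGrad, mul_comm]
  rw [← e1, ← e2]
  exact h

end WeakGradient

end SplittingMethod

end

open SplittingMethod

/-! Write `a`, `D`, `β` for the diffusion, Dirichlet and advection forms and `e u = ‖∇u‖`, a norm
equivalent to that of `H¹₀(Ω)` by the Poincaré inequality. Since `div b = 0`, `β u u = 0`, so `a`,
`α D`, `a + β` and `α D + β` are all coercive, and Lax-Milgram gives the solution and every step of
the iteration.

For convergence, let `w` be the solution and let `z` solve `α D z = a w`; then `(z, w)` is a fixed
point of the iteration, and the errors `p = u_{2n} - z`, `q = u_{2n+1} - w` satisfy the iteration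
with `f = 0`. Once an odd step has been made, `a q = α D p`, so `α D (p - q) = (a - α D) q` and the
discrepancy `p - q` is controlled by `‖A - α Id‖ / α` times `e q`. The next even error is driven by
`b · ∇(p - q)` alone, which costs `C_Ω ‖b‖ / α`, and the next odd step costs `α / α₁`. The product
of the three is the factor assumed to be less than one (`SplittingBounds.contraction`), so the odd
errors decay geometrically.

The concrete work is to verify these bounds (`splittingBounds`): finiteness of the Poincaré
constant, `advectionL_self`, and Hölder estimates. -/

namespace SplittingMethod

/-! ### The splitting iteration in an abstract Hilbert space -/

section Abstract

variable {H : Type*} [NormedAddCommGroup H] [InnerProductSpace ℝ H]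

/-- The Lax-Milgram theorem in variational form. -/
lemma existsUnique_of_isCoercive [CompleteSpace H] {B : H →L[ℝ] H →L[ℝ] ℝ} (hB : IsCoercive B)
    (l : H →L[ℝ] ℝ) : ∃! u : H, ∀ v, B u v = l v := by
  refine ⟨hB.continuousLinearEquivOfBilin.symm ((InnerProductSpace.toDual ℝ H).symm l), ?_, ?_⟩
  · intro v
    rw [← hB.continuousLinearEquivOfBilin_apply]
    simp
  · intro w hw
    rw [ContinuousLinearEquiv.eq_symm_apply]
    refine (ext_inner_right ℝ fun v => ?_)
    rw [hB.continuousLinearEquivOfBilin_apply, hw v]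
    simp

/-- Sequences built by a two-term recursion on pairs of consecutive terms. -/
lemma existsUnique_seq_of_existsUnique_step {X : Type*} {R : X → X → X → Prop} {S : X → X → Prop}
    (hR : ∀ p q, ∃! x, R p q x) (hS : ∀ x, ∃! y, S x y) (u₀ u₁ : X) :
    ∃! u : ℕ → X, u 0 = u₀ ∧ u 1 = u₁ ∧
      ∀ n, R (u (2 * n)) (u (2 * n + 1)) (u (2 * n + 2)) ∧ S (u (2 * n + 2)) (u (2 * n + 3)) := by
  choose r hr hr' using hR
  choose s hs hs' using hS
  -- `P n` is the pair of terms of index `2n` and `2n + 1`; `w` interleaves the two components.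
  let P : ℕ → X × X := fun n =>
    Nat.rec (u₀, u₁) (fun _ z => (r z.1 z.2, s (r z.1 z.2))) n
  let w : ℕ → X := fun n => if n % 2 = 0 then (P (n / 2)).1 else (P (n / 2)).2
  have we : ∀ n, w (2 * n) = (P n).1 := fun n => by simp [w]
  have wo : ∀ n, w (2 * n + 1) = (P n).2 := fun n => by
    have h1 : (2 * n + 1) % 2 = 1 := by omega
    have h2 : (2 * n + 1) / 2 = n := by omega
    simp [w, h1, h2]
  refine ⟨w, ⟨we 0, wo 0, fun n => ?_⟩, ?_⟩
  · have e : w (2 * n + 2) = r (P n).1 (P n).2 := we (n + 1)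
    have o : w (2 * n + 3) = s (r (P n).1 (P n).2) := wo (n + 1)
    rw [we, wo, e, o]
    exact ⟨hr _ _, hs _⟩
  · rintro u ⟨h0, h1, h⟩
    have key : ∀ n, u (2 * n) = (P n).1 ∧ u (2 * n + 1) = (P n).2 := by
      intro n
      induction n with
      | zero => exact ⟨h0, h1⟩
      | succ n ih =>
        have e : u (2 * n + 2) = r (P n).1 (P n).2 := by
          have := hr' _ _ _ (h n).1
          rwa [ih.1, ih.2] at this
        have o : u (2 * n + 3) = s (r (P n).1 (P n).2) := by
          have := hs' _ _ (h n).2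
          rwa [e] at this
        exact ⟨e, o⟩
    funext n
    obtain ⟨k, rfl | rfl⟩ := Nat.even_or_odd' n
    · rw [we, (key k).1]
    · rw [wo, (key k).2]

/-- The bounds on the diffusion form `a`, the Dirichlet form `D` and the advection form `β`, in
terms of the energy norm `e`, that make the splitting iteration converge. -/
structure SplittingBounds (a D β : H →L[ℝ] H →L[ℝ] ℝ) (e : H → ℝ) (α α₁ κ δ c : ℝ) : Prop where
  α_pos : 0 < α
  α₁_pos : 0 < α₁
  κ_nonneg : 0 ≤ κ
  δ_nonneg : 0 ≤ δ
  norm_le : ∀ u, ‖u‖ ≤ c * e u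
  energy_nonneg : ∀ u, 0 ≤ e u
  dirichlet_self : ∀ u, D u u = e u ^ 2
  dirichlet_le : ∀ u v, D u v ≤ e u * e v
  diffusion_self : ∀ u, α₁ * e u ^ 2 ≤ a u u
  advection_self : ∀ u, β u u = 0
  advection_le : ∀ u v, β u v ≤ κ * (e u * e v)
  diffusion_sub_le : ∀ u v, a u v - α * D u v ≤ δ * (e u * e v)

namespace SplittingBounds

variable {a D β : H →L[ℝ] H →L[ℝ] ℝ} {e : H → ℝ} {α α₁ κ δ c : ℝ}

lemma isCoercive (h : SplittingBounds a D β e α α₁ κ δ c) {B : H →L[ℝ] H →L[ℝ] ℝ} {m : ℝ}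
    (hm : 0 < m) (hB : ∀ u, m * e u ^ 2 ≤ B u u) : IsCoercive B := by
  -- `c` carries no sign condition; `1 + |c|` is a positive replacement that can be divided by.
  refine ⟨m / (1 + |c|) ^ 2, by positivity, fun u => le_trans ?_ (hB u)⟩
  have h1 : ‖u‖ ≤ (1 + |c|) * e u := (h.norm_le u).trans
    (mul_le_mul_of_nonneg_right (by linarith [le_abs_self c]) (h.energy_nonneg u))
  have h2 : ‖u‖ ^ 2 ≤ ((1 + |c|) * e u) ^ 2 := pow_le_pow_left₀ (norm_nonneg u) h1 2
  have h3 : 0 < (1 + |c|) ^ 2 := by positivity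
  rw [mul_assoc, ← sq, div_mul_eq_mul_div, div_le_iff₀ h3]
  nlinarith

/-- Three energy estimates, each obtained by testing an error equation with its own unknown: `p -
q`, then `x` (where the advection term drops out), then `y`. -/
lemma contraction (h : SplittingBounds a D β e α α₁ κ δ c) {p q x y : H}
    (h0 : ∀ v, a q v = α * D p v) (h1 : ∀ v, α * D x v + β x v = β (p - q) v)
    (h2 : ∀ v, a y v = α * D x v) : e y ≤ κ / α₁ * (δ / α) * e q := by
  have cancel : ∀ {s t m : ℝ}, 0 ≤ s → 0 ≤ t → m * s ^ 2 ≤ t * s → m * s ≤ t := by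
    intro s t m hs ht hst
    rcases hs.eq_or_lt with rfl | hs
    · simpa using ht
    · exact le_of_mul_le_mul_right (by linarith) hs
  have hα := h.α_pos
  have hα₁ := h.α₁_pos
  have eq0 := h.energy_nonneg q
  have er0 := h.energy_nonneg (p - q)
  have ex0 := h.energy_nonneg x
  have ey0 := h.energy_nonneg y
  have r1 : α * e (p - q) ≤ δ * e q := by
    refine cancel er0 (mul_nonneg h.δ_nonneg eq0) ?_
    -- By `h0`, the left side `a q v - α D q v` at `v = p - q` equals `α e (p - q) ^ 2`.
    have := h.diffusion_sub_le q (p - q)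
    rw [h0, ← mul_sub, ← sub_apply, ← map_sub, h.dirichlet_self] at this
    linarith
  have r2 : α * e x ≤ κ * e (p - q) := by
    refine cancel ex0 (mul_nonneg h.κ_nonneg er0) ?_
    have h3 := h1 x
    rw [h.advection_self, h.dirichlet_self, add_zero] at h3
    linarith [h.advection_le (p - q) x]
  have r3 : α₁ * e y ≤ α * e x := by
    refine cancel ey0 (mul_nonneg hα.le ex0) ?_
    have h3 := h.diffusion_self y
    rw [h2] at h3
    have := mul_le_mul_of_nonneg_left (h.dirichlet_le x y) hα.le
    linarith
  have r4 : α₁ * α * e y ≤ κ * δ * e q := by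
    have := mul_le_mul_of_nonneg_left r1 h.κ_nonneg
    have := mul_le_mul_of_nonneg_left (r3.trans r2) hα.le
    linarith
  rw [div_mul_div_comm, div_mul_eq_mul_div, le_div_iff₀ (by positivity)]
  linarith

variable [CompleteSpace H]

lemma existsUnique_solution (h : SplittingBounds a D β e α α₁ κ δ c) (l : H →L[ℝ] ℝ) :
    ∃! u : H, ∀ v, a u v + β u v = l v :=
  existsUnique_of_isCoercive (B := a + β) (h.isCoercive h.α₁_pos fun u => by
    simpa [h.advection_self] using h.diffusion_self u) l

lemma existsUnique_sequence (h : SplittingBounds a D β e α α₁ κ δ c) (l : H →L[ℝ] ℝ)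
    (u₀ u₁ : H) :
    ∃! u : ℕ → H, u 0 = u₀ ∧ u 1 = u₁ ∧ ∀ n,
      (∀ v, α * D (u (2 * n + 2)) v + β (u (2 * n + 2)) v =
        l v + β (u (2 * n) - u (2 * n + 1)) v) ∧
      ∀ v, a (u (2 * n + 3)) v = α * D (u (2 * n + 2)) v := by
  refine existsUnique_seq_of_existsUnique_step
    (R := fun p q x => ∀ v, α * D x v + β x v = l v + β (p - q) v)
    (S := fun x y => ∀ v, a y v = α * D x v) (fun p q => ?_) (fun x => ?_) u₀ u₁
  · exact existsUnique_of_isCoercive (B := α • D + β) (h.isCoercive h.α_pos fun u => by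
      simp [h.advection_self, h.dirichlet_self]) (l + β (p - q))
  · exact existsUnique_of_isCoercive (B := a) (h.isCoercive h.α₁_pos h.diffusion_self) (α • D x)

lemma tendsto (h : SplittingBounds a D β e α α₁ κ δ c) (hρ : κ / α₁ * (δ / α) < 1)
    {l : H →L[ℝ] ℝ} {w : H} (hw : ∀ v, a w v + β w v = l v) {u : ℕ → H}
    (heven : ∀ n v, α * D (u (2 * n + 2)) v + β (u (2 * n + 2)) v =
        l v + β (u (2 * n) - u (2 * n + 1)) v)
    (hodd : ∀ n v, a (u (2 * n + 3)) v = α * D (u (2 * n + 2)) v) :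
    Tendsto (fun n => u (2 * n + 1)) atTop (𝓝 w) := by
  -- `z` is the fixed point for the even iterates; it differs from `w` in general.
  obtain ⟨z, hz, -⟩ := existsUnique_of_isCoercive (B := α • D) (h.isCoercive h.α_pos fun u => by
    simp [h.dirichlet_self]) (a w)
  simp only [smul_apply, smul_eq_mul] at hz
  set ρ := κ / α₁ * (δ / α) with hρ_def
  have hρ0 : 0 ≤ ρ := by
    have := h.α_pos
    have := h.α₁_pos
    have := h.κ_nonneg
    have := h.δ_nonneg
    positivity
  have hodd' : ∀ n v, a (u (2 * n + 3) - w) v = α * D (u (2 * n + 2) - z) v := by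
    intro n v
    simp only [map_sub, sub_apply, mul_sub, hodd, hz]
  have heven' : ∀ n v, α * D (u (2 * n + 2) - z) v + β (u (2 * n + 2) - z) v =
      β (u (2 * n) - z - (u (2 * n + 1) - w)) v := by
    intro n v
    have h1 := heven n v
    simp only [map_sub, sub_apply] at h1 ⊢
    linarith [hz v, hw v]
  -- The decay is counted from `u 3`: the initial pair is arbitrary and need not satisfy the
  -- odd-step relation that the contraction requires.
  have bound : ∀ n, e (u (2 * n + 3) - w) ≤ ρ ^ n * e (u 3 - w) := by
    intro n
    induction n with
    | zero => simp
    | succ n ih =>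
      calc e (u (2 * (n + 1) + 3) - w) ≤ ρ * e (u (2 * n + 3) - w) :=
            h.contraction (hodd' n) (heven' (n + 1)) (hodd' (n + 1))
        _ ≤ ρ * (ρ ^ n * e (u 3 - w)) := mul_le_mul_of_nonneg_left ih hρ0
        _ = ρ ^ (n + 1) * e (u 3 - w) := by ring
  have hlim : Tendsto (fun n => |c| * (ρ ^ n * e (u 3 - w))) atTop (𝓝 0) := by
    simpa using ((tendsto_pow_atTop_nhds_zero_of_lt_one hρ0 hρ).mul_const
      (e (u 3 - w))).const_mul |c|
  rw [← tendsto_add_atTop_iff_nat 1, tendsto_iff_norm_sub_tendsto_zero]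
  refine squeeze_zero (fun n => norm_nonneg _) (fun n => ?_) hlim
  calc ‖u (2 * n + 3) - w‖ ≤ c * e (u (2 * n + 3) - w) := h.norm_le _
    _ ≤ |c| * e (u (2 * n + 3) - w) :=
        mul_le_mul_of_nonneg_right (le_abs_self c) (h.energy_nonneg _)
    _ ≤ |c| * (ρ ^ n * e (u 3 - w)) := mul_le_mul_of_nonneg_left (bound n) (abs_nonneg c)

end SplittingBounds

end Abstract

variable {d : ℕ} {Ω : TopologicalSpace.Opens (Eucl d)}

noncomputable instance : CompleteSpace (H10 Ω) := by
  unfold H10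
  infer_instance

/-! ### The Poincaré inequality on a bounded open set -/

section Poincare

/-- Integrating `x_i φ ∂_i φ` by parts gives `∫ φ² = -2 ∫ x_i φ ∂_i φ`; since `|x_i| ≤ R` on `Ω`,
Young's inequality absorbs half of `∫ φ²` into the left side. -/
lemma poincare_testFunction (i : Fin d) {R : ℝ} (hR : ∀ x ∈ Ω, ‖x‖ ≤ R) (φ : 𝓓(Ω, ℝ)) :
    ∫ x in (Ω : Set (Eucl d)), φ x ^ 2 ≤
      4 * R ^ 2 * ∫ x in (Ω : Set (Eucl d)), ‖gradient φ x‖ ^ 2 := by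
  set v : Eucl d := EuclideanSpace.single i 1
  have hφ : Differentiable ℝ φ := φ.contDiff.differentiable (by simp)
  have hc : Continuous fun x : Eucl d => x i := (EuclideanSpace.proj (𝕜 := ℝ) i).continuous
  have hφv : Continuous fun x => fderiv ℝ φ x v := continuous_partial φ i
  have hxi : ∀ x : Eucl d, HasFDerivAt (fun x : Eucl d => x i) (EuclideanSpace.proj (𝕜 := ℝ) i) x :=
    fun x => (EuclideanSpace.proj (𝕜 := ℝ) i).hasFDerivAt
  have hD : ∀ x, fderiv ℝ (fun x => x i * φ x) x v = φ x + x i * fderiv ℝ φ x v := by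
    intro x
    have h : HasFDerivAt (fun x => x i * φ x) _ x := (hxi x).mul (hφ x).hasFDerivAt
    rw [h.fderiv]
    simp [v]
    ring
  have i1 : Integrable (fun x => φ x ^ 2) := by
    simp_rw [sq]
    exact (φ.continuous.mul φ.continuous).integrable_of_hasCompactSupport
      φ.hasCompactSupport.mul_left
  have i2 : Integrable fun x => x i * (φ x * fderiv ℝ φ x v) :=
    (hc.mul (φ.continuous.mul hφv)).integrable_of_hasCompactSupport
      φ.hasCompactSupport.mul_right.mul_left
  have parts := integral_mul_fderiv_eq_neg_fderiv_mul_of_integrable (μ := (volume : Measure (Eucl d)))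
    (f := fun x => x i * φ x) (g := φ) (v := v)
    (by
      simp_rw [hD]
      refine (i1.add i2).congr (.of_forall fun x => ?_)
      simp only [Pi.add_apply]
      ring)
    (by simpa only [mul_assoc] using i2)
    (by
      simp_rw [mul_assoc]
      exact (hc.mul (φ.continuous.mul φ.continuous)).integrable_of_hasCompactSupport
        φ.hasCompactSupport.mul_right.mul_left)
    (fun x _ => ((hxi x).mul (hφ x).hasFDerivAt).differentiableAt) (fun x _ => hφ x)
  have e : ∫ x, φ x ^ 2 = - 2 * ∫ x, x i * (φ x * fderiv ℝ φ x v) := by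
    have h1 : ∫ x, fderiv ℝ (fun x => x i * φ x) x v * φ x =
        (∫ x, φ x ^ 2) + ∫ x, x i * (φ x * fderiv ℝ φ x v) := by
      rw [← integral_add i1 i2]
      congr 1
      ext x
      rw [hD]
      ring
    simp_rw [mul_assoc] at parts
    rw [h1] at parts
    linarith
  have hz : ∀ x, x ∉ (Ω : Set (Eucl d)) → φ x = 0 := fun x hx =>
    image_eq_zero_of_notMem_tsupport fun h => hx (φ.tsupport_subset h)
  have gradL2 : Integrable (fun x => ‖gradient φ x‖ ^ 2) := by
    simp_rw [gradient, LinearIsometryEquiv.norm_map, sq]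
    have hcf : Continuous (fderiv ℝ φ) := φ.contDiff.continuous_fderiv (by simp)
    exact (hcf.norm.mul hcf.norm).integrable_of_hasCompactSupport
      (φ.hasCompactSupport.fderiv (𝕜 := ℝ)).norm.mul_left
  rw [← setIntegral_eq_integral_of_forall_compl_eq_zero (s := (Ω : Set (Eucl d)))
      (fun x hx => by simp [hz x hx]),
    ← setIntegral_eq_integral_of_forall_compl_eq_zero (s := (Ω : Set (Eucl d)))
      (f := fun x => x i * (φ x * fderiv ℝ φ x v)) (fun x hx => by simp [hz x hx])] at e
  have key : ∫ x in (Ω : Set (Eucl d)), (-2) * (x i * (φ x * fderiv ℝ φ x v)) ≤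
      ∫ x in (Ω : Set (Eucl d)), (1 / 2 * φ x ^ 2 + 2 * R ^ 2 * ‖gradient φ x‖ ^ 2) := by
    refine setIntegral_mono_on (i2.const_mul _).integrableOn
      ((i1.const_mul _).add (gradL2.const_mul _)).integrableOn Ω.isOpen.measurableSet ?_
    intro x hx
    have h1 : |x i| ≤ R := (PiLp.norm_apply_le x i).trans (hR x hx)
    have h2 : |fderiv ℝ φ x v| ≤ ‖gradient φ x‖ := by
      rw [← gradient_coord]
      exact PiLp.norm_apply_le (gradient φ x) i
    have h3 : |x i * fderiv ℝ φ x v| ≤ R * ‖gradient φ x‖ := by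
      rw [abs_mul]
      exact mul_le_mul h1 h2 (abs_nonneg _) ((abs_nonneg _).trans h1)
    have h4 : (x i * fderiv ℝ φ x v) ^ 2 ≤ (R * ‖gradient φ x‖) ^ 2 :=
      sq_le_sq' (abs_le.1 h3).1 (abs_le.1 h3).2
    -- Young's inequality `-2 φ t ≤ φ² / 2 + 2 t²` with `t = x_i ∂_i φ`.
    nlinarith [sq_nonneg (φ x + 2 * (x i * fderiv ℝ φ x v))]
  rw [integral_const_mul, ← e, integral_add (i1.const_mul _).integrableOn
    (gradL2.const_mul _).integrableOn, integral_const_mul, integral_const_mul] at key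
  linarith

lemma norm_sq_eq_integral {F : Type*} [NormedAddCommGroup F] [InnerProductSpace ℝ F]
    (g : Lp F 2 (vol Ω)) : ‖g‖ ^ 2 = ∫ x in (Ω : Set (Eucl d)), ‖g x‖ ^ 2 := by
  rw [← real_inner_self_eq_norm_sq, L2.inner_def]
  simp_rw [real_inner_self_eq_norm_sq]

lemma exists_poincare (hd : 1 ≤ d) (hΩ : Bornology.IsBounded (Ω : Set (Eucl d))) :
    ∃ C : ℝ, 0 ≤ C ∧ ∀ u : H10 Ω, ‖toFn u‖ ≤ C * ‖weakGrad u‖ := by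
  obtain ⟨R, hR⟩ := hΩ.exists_norm_le
  have hR' : ∀ x ∈ Ω, ‖x‖ ≤ |R| := fun x hx => (hR x hx).trans (le_abs_self R)
  refine ⟨2 * |R|, by positivity, fun u => ?_⟩
  -- The inequality is a closed condition on pairs, so it passes from test functions to their
  -- closure.
  have hcl : IsClosed {z : L2Pair Ω | ‖z.fst‖ ≤ 2 * |R| * ‖z.snd‖} :=
    isClosed_le (WithLp.continuous_fst ..).norm
      (continuous_const.mul (WithLp.continuous_snd ..).norm)
  refine closure_minimal (s := (testPairs Ω : Set (L2Pair Ω))) ?_ hcl u.2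
  rintro z ⟨φ, h1, h2⟩
  show ‖z.fst‖ ≤ 2 * |R| * ‖z.snd‖
  refine le_of_sq_le_sq ?_ (by positivity)
  have e1 : ‖z.fst‖ ^ 2 = ∫ x in (Ω : Set (Eucl d)), φ x ^ 2 := by
    rw [norm_sq_eq_integral]
    exact integral_congr_ae (h1.mono fun x hx => by simp [hx])
  have e2 : ‖z.snd‖ ^ 2 = ∫ x in (Ω : Set (Eucl d)), ‖gradient φ x‖ ^ 2 := by
    rw [norm_sq_eq_integral]
    exact integral_congr_ae (h2.mono fun x hx => by simp only [hx])
  have := poincare_testFunction ⟨0, hd⟩ hR' φ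
  rw [mul_pow, mul_pow, e1, e2]
  linarith

lemma poincareConstant_nonneg : 0 ≤ poincareConstant Ω := Real.sInf_nonneg fun _ h => h.1

/-- The infimum in the definition of the Poincaré constant of a bounded open set is attained. -/
lemma norm_toFn_le (hd : 1 ≤ d) (hΩ : Bornology.IsBounded (Ω : Set (Eucl d))) (u : H10 Ω) :
    ‖toFn u‖ ≤ poincareConstant Ω * ‖weakGrad u‖ := by
  obtain ⟨C, hC0, hC⟩ := exists_poincare hd hΩ
  -- With zero gradient any admissible `C` forces `‖toFn u‖ = 0`; otherwise the quotient of norms is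
  -- a lower bound of the set of admissible constants.
  rcases (norm_nonneg (weakGrad u)).eq_or_lt with h0 | h0
  · simpa [← h0] using hC u
  · rw [← div_le_iff₀ h0]
    exact le_csInf ⟨C, hC0, hC⟩ fun K hK => (div_le_iff₀ h0).2 (hK.2 u)

lemma norm_le_norm_weakGrad (hd : 1 ≤ d) (hΩ : Bornology.IsBounded (Ω : Set (Eucl d)))
    (u : H10 Ω) : ‖u‖ ≤ (poincareConstant Ω + 1) * ‖weakGrad u‖ := by
  have hP := poincareConstant_nonneg (Ω := Ω)
  refine le_of_sq_le_sq ?_ (by positivity)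
  have h1 : ‖u‖ ^ 2 = ‖toFn u‖ ^ 2 + ‖weakGrad u‖ ^ 2 := WithLp.prod_norm_sq_eq_of_L2 _
  have h2 := pow_le_pow_left₀ (norm_nonneg _) (norm_toFn_le hd hΩ u) 2
  rw [h1]
  nlinarith [mul_nonneg hP (sq_nonneg ‖weakGrad u‖)]

end Poincare

/-! ### The concrete forms and their bounds -/

section Forms

variable (Ω) in
/-- `toFn` as a continuous linear map. -/
noncomputable def toFnL : H10 Ω →L[ℝ] Lp ℝ 2 (vol Ω) :=
  (WithLp.fstL 2 ℝ _ _).comp (H10 Ω).subtypeL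

variable (Ω) in
/-- `weakGrad` as a continuous linear map. -/
noncomputable def weakGradL : H10 Ω →L[ℝ] Lp (Eucl d) 2 (vol Ω) :=
  (WithLp.sndL 2 ℝ _ _).comp (H10 Ω).subtypeL

@[simp] lemma toFnL_apply (u : H10 Ω) : toFnL Ω u = toFn u := rfl

@[simp] lemma weakGradL_apply (u : H10 Ω) : weakGradL Ω u = weakGrad u := rfl

variable (Ω) in
/-- The Dirichlet form as a continuous bilinear form. -/
noncomputable def dirichletL : H10 Ω →L[ℝ] H10 Ω →L[ℝ] ℝ :=
  (innerSL ℝ).bilinearComp (weakGradL Ω) (weakGradL Ω)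

lemma dirichletL_eq_inner (u v : H10 Ω) :
    dirichletL Ω u v = inner ℝ (weakGrad u) (weakGrad v) := rfl

lemma dirichletL_apply (u v : H10 Ω) : dirichletL Ω u v = dirichletForm u v :=
  L2.inner_def ..

/-- Multiplication by a bounded field of operators, as an operator on `L²(Ω)`. -/
noncomputable def mulOp {F : Type*} [NormedAddCommGroup F] [NormedSpace ℝ F]
    {T : Eucl d → Eucl d →L[ℝ] F} (hT : MemLp T ∞ (vol Ω)) :
    Lp (Eucl d) 2 (vol Ω) →L[ℝ] Lp F 2 (vol Ω) :=
  (ContinuousLinearMap.id ℝ (Eucl d →L[ℝ] F)).holderL (vol Ω) ∞ 2 2 hT.toLp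

lemma coeFn_mulOp {F : Type*} [NormedAddCommGroup F] [NormedSpace ℝ F]
    {T : Eucl d → Eucl d →L[ℝ] F} (hT : MemLp T ∞ (vol Ω)) (g : Lp (Eucl d) 2 (vol Ω)) :
    mulOp hT g =ᵐ[vol Ω] fun x => T x (g x) := by
  filter_upwards [(ContinuousLinearMap.id ℝ (Eucl d →L[ℝ] F)).coeFn_holder (r := 2) hT.toLp g,
    hT.coeFn_toLp] with x h1 h2
  rw [h2] at h1
  exact h1

lemma norm_mulOp_apply_le {F : Type*} [NormedAddCommGroup F] [NormedSpace ℝ F]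
    {T : Eucl d → Eucl d →L[ℝ] F} (hT : MemLp T ∞ (vol Ω)) (g : Lp (Eucl d) 2 (vol Ω)) :
    ‖mulOp hT g‖ ≤ linftyNorm Ω T * ‖g‖ := by
  have h := (ContinuousLinearMap.id ℝ (Eucl d →L[ℝ] F)).norm_holder_apply_apply_le (r := 2)
    hT.toLp g
  rw [Lp.norm_toLp] at h
  refine h.trans (mul_le_mul_of_nonneg_right ?_ (norm_nonneg _))
  exact (mul_le_mul_of_nonneg_right ContinuousLinearMap.norm_id_le ENNReal.toReal_nonneg).trans
    (one_mul _).le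

variable {A : Eucl d → Matrix (Fin d) (Fin d) ℝ} {b : Eucl d → Eucl d} {f : Eucl d → ℝ}

/-- Reduces measurability and boundedness of the operator field to those of the matrix entries. -/
lemma matMap_eq_sum (M : Matrix (Fin d) (Fin d) ℝ) :
    matMap M = ∑ i, ∑ j, M i j • matMap (Matrix.single i j (1 : ℝ)) := by
  conv_lhs => rw [Matrix.matrix_eq_sum_single M]
  simp only [matMap, map_sum, ← map_smul, Matrix.smul_single, smul_eq_mul, mul_one]

lemma memLp_top_finsetSum {ι F : Type*} [NormedAddCommGroup F] {s : Finset ι}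
    {g : ι → Eucl d → F} (hg : ∀ i, MemLp (g i) ∞ (vol Ω)) :
    MemLp (fun x => ∑ i ∈ s, g i x) ∞ (vol Ω) :=
  memLp_finsetSum _ fun i _ => hg i

lemma memLp_sum_smul_const (hA : ∀ i j, MemLp (fun x => A x i j) ∞ (vol Ω))
    (T : Fin d → Fin d → Eucl d →L[ℝ] Eucl d) :
    MemLp (fun x => ∑ i, ∑ j, A x i j • T i j) ∞ (vol Ω) :=
  memLp_top_finsetSum fun i => memLp_top_finsetSum fun j =>
    (ContinuousLinearMap.toSpanSingleton ℝ (T i j)).comp_memLp' (hA i j)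

lemma memLp_matMap (hA : ∀ i j, MemLp (fun x => A x i j) ∞ (vol Ω)) :
    MemLp (fun x => matMap (A x)) ∞ (vol Ω) := by
  rw [funext fun x => matMap_eq_sum (A x)]
  exact memLp_sum_smul_const hA fun i j => matMap (Matrix.single i j (1 : ℝ))

lemma memLp_matMap_sub (hA : ∀ i j, MemLp (fun x => A x i j) ∞ (vol Ω))
    (α : ℝ) :
    MemLp (fun x => matMap (A x - α • (1 : Matrix (Fin d) (Fin d) ℝ))) ∞ (vol Ω) := by
  refine memLp_matMap fun i j => (hA i j).sub (memLp_top_const _)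

lemma memLp_innerSL (hb : MemLp b ∞ (vol Ω)) : MemLp (fun x => innerSL ℝ (b x)) ∞ (vol Ω) :=
  (innerSL ℝ).comp_memLp' hb

lemma linftyNorm_innerSL : linftyNorm Ω (fun x => innerSL ℝ (b x)) = linftyNorm Ω b := by
  unfold linftyNorm
  rw [eLpNorm_congr_norm_ae (g := b) (.of_forall fun x => innerSL_apply_norm ..)]

/-- The diffusion form as a continuous bilinear form. -/
noncomputable def diffusionL (hA : MemLp (fun x => matMap (A x)) ∞ (vol Ω)) :
    H10 Ω →L[ℝ] H10 Ω →L[ℝ] ℝ :=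
  (innerSL ℝ).bilinearComp ((mulOp hA).comp (weakGradL Ω)) (weakGradL Ω)

lemma diffusionL_eq_inner (hA : MemLp (fun x => matMap (A x)) ∞ (vol Ω)) (u v : H10 Ω) :
    diffusionL hA u v = inner ℝ (mulOp hA (weakGrad u)) (weakGrad v) := rfl

lemma diffusionL_apply (hA : MemLp (fun x => matMap (A x)) ∞ (vol Ω)) (u v : H10 Ω) :
    diffusionL hA u v = diffusionForm A u v := by
  rw [diffusionL_eq_inner, L2.inner_def, diffusionForm]
  exact integral_congr_ae ((coeFn_mulOp hA (weakGrad u)).mono fun x hx => by simp only [hx])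

/-- The advection form as a continuous bilinear form. -/
noncomputable def advectionL (hb : MemLp b ∞ (vol Ω)) : H10 Ω →L[ℝ] H10 Ω →L[ℝ] ℝ :=
  (innerSL ℝ).bilinearComp ((mulOp (memLp_innerSL hb)).comp (weakGradL Ω)) (toFnL Ω)

lemma advectionL_eq_inner (hb : MemLp b ∞ (vol Ω)) (u v : H10 Ω) :
    advectionL hb u v = inner ℝ (mulOp (memLp_innerSL hb) (weakGrad u)) (toFn v) := rfl

lemma advectionL_apply (hb : MemLp b ∞ (vol Ω)) (u v : H10 Ω) :
    advectionL hb u v = advectionForm b u v := by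
  rw [advectionL_eq_inner, L2.inner_def, advectionForm]
  exact integral_congr_ae ((coeFn_mulOp (memLp_innerSL hb) (weakGrad u)).mono fun x hx => by
    simp [hx, mul_comm])

/-- The load as a continuous linear form. -/
noncomputable def loadL (hf : MemLp f 2 (vol Ω)) : H10 Ω →L[ℝ] ℝ :=
  (innerSL ℝ hf.toLp).comp (toFnL Ω)

lemma loadL_apply (hf : MemLp f 2 (vol Ω)) (v : H10 Ω) : loadL hf v = load f v := by
  have h : loadL hf v = inner ℝ hf.toLp (toFn v) := rfl
  rw [h, L2.inner_def, load]
  exact integral_congr_ae (hf.coeFn_toLp.mono fun x hx => by simp [hx, mul_comm])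

/-- The square of a test function. -/
noncomputable def sqTestFunction (φ : 𝓓(Ω, ℝ)) : 𝓓(Ω, ℝ) where
  toFun x := φ x * φ x
  contDiff' := φ.contDiff.mul φ.contDiff
  hasCompactSupport' := φ.hasCompactSupport.mul_left
  tsupport_subset' := (tsupport_mul_subset_left ..).trans φ.tsupport_subset

lemma gradient_sqTestFunction (φ : 𝓓(Ω, ℝ)) (x : Eucl d) :
    gradient (sqTestFunction φ) x = (2 * φ x) • gradient φ x := by
  have hφ : DifferentiableAt ℝ φ x := φ.contDiff.differentiable (by simp) x
  have h : fderiv ℝ (sqTestFunction φ) x = φ x • fderiv ℝ φ x + φ x • fderiv ℝ φ x :=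
    fderiv_mul hφ hφ
  rw [gradient, h, ← add_smul, ← two_mul, map_smul]
  rfl

/-- The advection form of a divergence-free field vanishes on the diagonal. -/
lemma advectionL_self (hb : MemLp b ∞ (vol Ω)) (hdiv : IsDivFree Ω b) (u : H10 Ω) :
    advectionL hb u u = 0 := by
  have hcl : IsClosed {z : L2Pair Ω | inner ℝ (mulOp (memLp_innerSL hb) z.snd) z.fst = 0} :=
    isClosed_eq (((mulOp (memLp_innerSL hb)).continuous.comp (WithLp.continuous_snd ..)).inner
      (WithLp.continuous_fst ..)) continuous_const
  refine closure_minimal (s := (testPairs Ω : Set (L2Pair Ω))) ?_ hcl u.2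
  rintro z ⟨φ, h1, h2⟩
  -- Testing `div b = 0` with `φ²` gives `2 ∫ φ b · ∇φ = 0`; density of test functions does the
  -- rest.
  have h := hdiv (sqTestFunction φ)
  simp_rw [gradient_sqTestFunction, inner_smul_right, mul_assoc] at h
  rw [integral_const_mul] at h
  show inner ℝ _ _ = 0
  rw [L2.inner_def, ← (mul_eq_zero.1 h).resolve_left two_ne_zero]
  refine integral_congr_ae ?_
  filter_upwards [coeFn_mulOp (memLp_innerSL hb) z.snd, h1, h2] with x a b c
  rw [a, b, c]
  simp

/-- Ellipticity, with the exceptional null set independent of the vector. -/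
lemma IsElliptic.ae_le {α₁ α₂ : ℝ} (h : IsElliptic Ω A α₁ α₂) :
    ∀ᵐ x ∂(vol Ω), ∀ ξ : Eucl d, α₁ * ‖ξ‖ ^ 2 ≤ inner ℝ (matMap (A x) ξ) ξ := by
  -- The null sets of a countable dense family of vectors have a null union; continuity in `ξ`
  -- extends the bound to all vectors.
  have h1 := ae_all_iff.2 fun n : ℕ => h.2.2 (TopologicalSpace.denseSeq (Eucl d) n)
  filter_upwards [h1] with x hx ξ
  have hcl : IsClosed {ξ : Eucl d | α₁ * ‖ξ‖ ^ 2 ≤ inner ℝ (matMap (A x) ξ) ξ} :=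
    isClosed_le (by fun_prop) ((matMap (A x)).continuous.inner continuous_id)
  have hsub : Set.range (TopologicalSpace.denseSeq (Eucl d)) ⊆
      {ξ : Eucl d | α₁ * ‖ξ‖ ^ 2 ≤ inner ℝ (matMap (A x) ξ) ξ} := by
    rintro _ ⟨n, rfl⟩
    exact (hx n).1
  exact closure_minimal hsub hcl (TopologicalSpace.denseRange_denseSeq _ ξ)

lemma le_diffusionL_self {α₁ α₂ : ℝ} (h : IsElliptic Ω A α₁ α₂)
    (hA : MemLp (fun x => matMap (A x)) ∞ (vol Ω)) (u : H10 Ω) :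
    α₁ * ‖weakGrad u‖ ^ 2 ≤ diffusionL hA u u := by
  rw [diffusionL_eq_inner, L2.inner_def, norm_sq_eq_integral, ← integral_const_mul]
  refine integral_mono_ae ?_ (L2.integrable_inner _ _) ?_
  · simpa only [real_inner_self_eq_norm_sq] using
      (L2.integrable_inner (𝕜 := ℝ) (weakGrad u) (weakGrad u)).const_mul α₁
  · filter_upwards [h.ae_le, coeFn_mulOp hA (weakGrad u)] with x hx h1
    rw [h1]
    exact hx _

lemma diffusionL_sub (hA : MemLp (fun x => matMap (A x)) ∞ (vol Ω)) {α : ℝ}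
    (hA' : MemLp (fun x => matMap (A x - α • (1 : Matrix (Fin d) (Fin d) ℝ))) ∞ (vol Ω))
    (u v : H10 Ω) : diffusionL hA u v - α * dirichletL Ω u v = diffusionL hA' u v := by
  rw [diffusionL_eq_inner, diffusionL_eq_inner, dirichletL_eq_inner, ← real_inner_smul_left,
    ← inner_sub_left]
  congr 1
  refine Lp.ext ?_
  filter_upwards [coeFn_mulOp hA (weakGrad u), coeFn_mulOp hA' (weakGrad u),
    Lp.coeFn_sub (mulOp hA (weakGrad u)) (α • weakGrad u), Lp.coeFn_smul α (weakGrad u)]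
    with x h1 h2 h3 h4
  rw [h3, Pi.sub_apply, h1, h2, h4]
  simp [matMap, map_sub, map_smul]

lemma splittingBounds (hd : 1 ≤ d) (hΩ : Bornology.IsBounded (Ω : Set (Eucl d)))
    (hA : ∀ i j, MemLp (fun x => A x i j) ∞ (vol Ω)) {α₁ α₂ : ℝ} (hell : IsElliptic Ω A α₁ α₂)
    (hb : MemLp b ∞ (vol Ω)) (hdiv : IsDivFree Ω b) {α : ℝ} (hα : 0 < α) :
    SplittingBounds (diffusionL (memLp_matMap hA)) (dirichletL Ω) (advectionL hb)
      (fun u => ‖weakGrad u‖) α α₁ (poincareConstant Ω * linftyNorm Ω b)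
      (linftyNorm Ω fun x => matMap (A x - α • (1 : Matrix (Fin d) (Fin d) ℝ)))
      (poincareConstant Ω + 1) where
  α_pos := hα
  α₁_pos := hell.1
  κ_nonneg := mul_nonneg poincareConstant_nonneg ENNReal.toReal_nonneg
  δ_nonneg := ENNReal.toReal_nonneg
  norm_le := norm_le_norm_weakGrad hd hΩ
  energy_nonneg _ := norm_nonneg _
  dirichlet_self u := real_inner_self_eq_norm_sq (weakGrad u)
  dirichlet_le u v := real_inner_le_norm (weakGrad u) (weakGrad v)
  diffusion_self := le_diffusionL_self hell _
  advection_self := advectionL_self hb hdiv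
  advection_le u v := by
    have h := norm_mulOp_apply_le (memLp_innerSL hb) (weakGrad u)
    rw [linftyNorm_innerSL] at h
    calc advectionL hb u v ≤ ‖mulOp (memLp_innerSL hb) (weakGrad u)‖ * ‖toFn v‖ :=
          real_inner_le_norm (mulOp (memLp_innerSL hb) (weakGrad u)) (toFn v)
      _ ≤ linftyNorm Ω b * ‖weakGrad u‖ * (poincareConstant Ω * ‖weakGrad v‖) :=
          mul_le_mul h (norm_toFn_le hd hΩ v) (norm_nonneg _)
            (mul_nonneg ENNReal.toReal_nonneg (norm_nonneg _))
      _ = poincareConstant Ω * linftyNorm Ω b * (‖weakGrad u‖ * ‖weakGrad v‖) := by ring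
  diffusion_sub_le u v := by
    rw [diffusionL_sub _ (memLp_matMap_sub hA α), ← mul_assoc]
    exact (real_inner_le_norm (mulOp (memLp_matMap_sub hA α) (weakGrad u)) (weakGrad v)).trans
      (mul_le_mul_of_nonneg_right (norm_mulOp_apply_le _ _) (norm_nonneg _))

end Forms

end SplittingMethod

theorem mainTheorem6 (d : ℕ) (hd : 1 ≤ d)
    (Ω : TopologicalSpace.Opens (Eucl d)) (hΩ : Bornology.IsBounded (Ω : Set (Eucl d)))
    (A : Eucl d → Matrix (Fin d) (Fin d) ℝ)
    (hA : ∀ i j, MemLp (fun x => A x i j) ∞ (vol Ω))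
    (α₁ α₂ : ℝ) (hell : IsElliptic Ω A α₁ α₂)
    (b : Eucl d → Eucl d) (hb : MemLp b ∞ (vol Ω)) (hdiv : IsDivFree Ω b)
    (f : Eucl d → ℝ) (hf : MemLp f 2 (vol Ω))
    (αspl : ℝ) (hspl : 0 < αspl)
    (hρ : poincareConstant Ω * linftyNorm Ω b / α₁ *
      (linftyNorm Ω (fun x => matMap (A x - αspl • (1 : Matrix (Fin d) (Fin d) ℝ))) / αspl) < 1) :
    (∃! uε : H10 Ω, IsSolution A b f uε) ∧
    (∀ u₀ u₁ : H10 Ω, ∃! u : ℕ → H10 Ω,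
      u 0 = u₀ ∧ u 1 = u₁ ∧ IsSplittingSequence A b f αspl u) ∧
    ∀ uε : H10 Ω, IsSolution A b f uε →
      ∀ u : ℕ → H10 Ω, IsSplittingSequence A b f αspl u →
        Tendsto (fun n => u (2 * n + 1)) atTop (𝓝 uε) := by
  have h := splittingBounds hd hΩ hA hell hb hdiv hspl
  refine ⟨?_, fun u₀ u₁ => ?_, fun w hw u hu => ?_⟩
  · simpa only [IsSolution, diffusionL_apply, advectionL_apply, loadL_apply] using
      h.existsUnique_solution (loadL hf)
  · have hiff : ∀ u : ℕ → H10 Ω, IsSplittingSequence A b f αspl u ↔ ∀ n,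
        (∀ v, αspl * dirichletForm (u (2 * n + 2)) v + advectionForm b (u (2 * n + 2)) v =
          load f v + advectionForm b (u (2 * n) - u (2 * n + 1)) v) ∧
        ∀ v, diffusionForm A (u (2 * n + 3)) v = αspl * dirichletForm (u (2 * n + 2)) v :=
      fun u => ⟨fun hu n => ⟨hu.even_step n, hu.odd_step n⟩,
        fun hu => ⟨fun n => (hu n).1, fun n => (hu n).2⟩⟩
    simpa only [hiff, diffusionL_apply, advectionL_apply, dirichletL_apply, loadL_apply] using
      h.existsUnique_sequence (loadL hf) u₀ u₁
  · refine h.tendsto hρ (l := loadL hf) ?_ ?_ ?_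
    · simpa only [IsSolution, diffusionL_apply, advectionL_apply, loadL_apply] using hw
    · simpa only [dirichletL_apply, advectionL_apply, loadL_apply] using hu.even_step
    · simpa only [diffusionL_apply, dirichletL_apply] using hu.odd_step
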